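/- Setting. All events are elements of a complete atomic Boolean algebra with top $\Omega$ (the sure event) and bottom $\emptyset$. For a set $\mathcal G$ of events, $\langle\mathcal G\rangle$ is the Boolean algebra generated by $\mathcal G$, and $\langle\mathcal G\rangle^*$ is the smallest Boolean algebra containing $\mathcal G$ that is closed under arbitrary disjunctions and conjunctions. Let $\mathcal L=\{H_i\}_{i\in I}$ and $\mathcal E=\{E_j\}_{j\in J}$ be two partitions of $\Omega$ (into non-empty events, with arbitrary index sets). Let $\mathcal A_{\mathcal L},\mathcal A_{\mathcal E},\mathcal A$ be Boolean algebras with $\langle\mathcal L\rangle\subseteq\mathcal A_{\mathcal L}\subseteq\langle\mathcal L\rangle^*$, $\langle\mathcal E\rangle\subseteq\mathcal A_{\mathcal E}\subseteq\langle\mathcal E\rangle^*$ and $\langle\mathcal A_{\mathcal L}\cup\mathcal A_{\mathcal E}\rangle\subseteq\mathcal A\subseteq\langle\mathcal A_{\mathcal L}\cup\mathcal A_{\mathcal E}\rangle^*$, and put $\mathcal A^0=\mathcal A\setminus\{\emptyset\}$. Let $\pi$ be a finitely additive probability on $\mathcal A_{\mathcal L}$. Let $\sigma$ be a strategy on $\mathcal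 A\times\mathcal L$, i.e. for every $i\in I$, $\sigma(\cdot|H_i)$ is a finitely additive probability on $\mathcal A$ with $\sigma(F|H_i)=1$ whenever $F\in\mathcal A$ and $F\wedge H_i=H_i$. Assume that for every $F\in\mathcal A$ the function $X=\sigma(F|\cdot):\mathcal L\to[0,1]$ is $\mathcal A_{\mathcal L}$-continuous: for all $t\in\mathbb R$ and $\epsilon>0$ there is $A\in\mathcal A_{\mathcal L}$ with $(X\ge t+\epsilon)\subseteq A\subseteq(X\ge t)$, where $(X\ge t)=\bigvee\{H_i: X(H_i)\ge t\}$. Then for every $F\in\mathcal A$ the function $\sigma(F|\cdot)$ is Stieltjes integrable with respect to $\pi$, i.e. the lower integral $\sup\sum_{u}\big(\inf_{H_i\subseteq A_u}\sigma(F|H_i)\big)\pi(A_u)$ and the upper integral $\inf\sum_{u}\big(\sup_{H_i\subseteq A_u}\sigma(F|H_i)\big)\pi(A_u)$ coincide, where the supremum and the infimum are over the finite partitions $\{A_u\}$ of $\Omega$ contained in $\mathcal A_{\mathcal L}$. Denote the common value by $P^{\mathbf d}(F)=\int\sigma(F|H_i)\,\pi(\mathrm dH_i)$. A full conditional probability on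 $\mathcal A$ is a function $P$ on $\mathcal A\times\mathcal A^0$ such that $P(E|K)=P(E\wedge K|K)$ for all $E\in\mathcal A$ and $K\in\mathcal A^0$; $P(\cdot|K)$ is a finitely additive probability on $\mathcal A$ for all $K\in\mathcal A^0$; and $P(E\wedge F|K)=P(E|K)\,P(F|E\wedge K)$ for all $E,F\in\mathcal A$ and $K,E\wedge K\in\mathcal A^0$. Let $\mathcal P^{\mathbf d}$ be the set of full conditional probabilities $\tilde P$ on $\mathcal A$ extending $\{P^{\mathbf d},\sigma\}$, i.e. $\tilde P(F|\Omega)=P^{\mathbf d}(F)$ and $\tilde P(F|H_i)=\sigma(F|H_i)$ for all $F\in\mathcal A$ and $i\in I$. Theorem. For every $F\in\mathcal A$ and $K\in\mathcal A^0$ the minimum $\underline P^{\mathbf d}(F|K)=\min\{\tilde P(F|K):\tilde P\in\mathcal P^{\mathbf d}\}$ exists (in particular $\mathcal P^{\mathbf d}\ne\emptyset$). It equals $1$ if $F\wedge K=K$. If $F\wedge K\neq K$, then: (i) if $P^{\mathbf d}(K)>0$, then $\underline P^{\mathbf d}(F|K)=\dfrac{P^{\mathbf d}(F\wedge K)}{P^{\mathbf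 d}(K)}$; (ii) if $P^{\mathbf d}(K)=0$, then $$\underline P^{\mathbf d}(F|K)=\begin{cases}\displaystyle\min_{i\in I_2}\frac{\sigma(F\wedge K|H_i)}{\sigma(K|H_i)} & \text{if } I_2\ne\emptyset=I_3,\ I_2 \text{ is finite, and } \sigma(K|H_i)>0 \text{ for all } i\in I_2,\\[2ex] 0 & \text{otherwise,}\end{cases}$$ where $I_2=\{i\in I: H_i\wedge F\wedge K\ne\emptyset\ne H_i\wedge F^c\wedge K\}$ and $I_3=\{i\in I: H_i\wedge F\wedge K=\emptyset\ne H_i\wedge F^c\wedge K\}$. -/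

import Mathlib

noncomputable section

open Set

namespace Envelope

/-- A partition of the sure event `⊤`: an indexed family of pairwise incompatible possible
events whose disjunction is `⊤`. -/
structure IsPartition {𝓑 I : Type*} [CompleteAtomicBooleanAlgebra 𝓑] (H : I → 𝓑) : Prop where
  ne_bot : ∀ i, H i ≠ ⊥
  disjoint : ∀ i j, i ≠ j → Disjoint (H i) (H j)
  iSup_eq_top : ⨆ i, H i = ⊤

/-- `⟨G⟩*`: the smallest subalgebra containing `G` and closed under arbitrary disjunctions and
conjunctions. (Atomicity is automatic: a complete subalgebra of a complete atomic Boolean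
algebra is atomic.) -/
def completeClosure {𝓑 : Type*} [CompleteAtomicBooleanAlgebra 𝓑] (G : Set 𝓑) :
    BooleanSubalgebra 𝓑 :=
  sInf {S | G ⊆ (S : Set 𝓑) ∧ ∀ T : Set 𝓑, T ⊆ (S : Set 𝓑) → sSup T ∈ S ∧ sInf T ∈ S}

/-- `p` (restricted to `A`) is a finitely additive probability on the algebra `A`.
Values of `p` outside `A` are irrelevant. -/
structure IsFinAddProb {𝓑 : Type*} [CompleteAtomicBooleanAlgebra 𝓑]
    (A : BooleanSubalgebra 𝓑) (p : 𝓑 → ℝ) : Prop where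
  nonneg : ∀ F ∈ A, 0 ≤ p F
  top : p ⊤ = 1
  sup_of_disjoint : ∀ F ∈ A, ∀ G ∈ A, Disjoint F G → p (F ⊔ G) = p F + p G

/-- `σ` is a strategy on `A × L`, where `L = {H i}`; `σ F i` is `σ(F | H i)`. -/
structure IsStrategy {𝓑 I : Type*} [CompleteAtomicBooleanAlgebra 𝓑] (H : I → 𝓑)
    (A : BooleanSubalgebra 𝓑) (σ : 𝓑 → I → ℝ) : Prop where
  eq_one : ∀ i, ∀ F ∈ A, F ⊓ H i = H i → σ F i = 1
  finAddProb : ∀ i, IsFinAddProb A (fun F => σ F i)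

/-- `P` (restricted to `A × (A \ {⊥})`) is a full conditional probability on `A`;
`P F K` is `P(F | K)`. Values outside `A × (A \ {⊥})` are irrelevant. -/
structure IsFullCondProb {𝓑 : Type*} [CompleteAtomicBooleanAlgebra 𝓑]
    (A : BooleanSubalgebra 𝓑) (P : 𝓑 → 𝓑 → ℝ) : Prop where
  inf_self : ∀ F ∈ A, ∀ K ∈ A, K ≠ ⊥ → P F K = P (F ⊓ K) K
  finAddProb : ∀ K ∈ A, K ≠ ⊥ → IsFinAddProb A (fun F => P F K)
  chain : ∀ E ∈ A, ∀ F ∈ A, ∀ K ∈ A, K ≠ ⊥ → E ⊓ K ≠ ⊥ →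
    P (E ⊓ F) K = P E K * P F (E ⊓ K)

/-- The lower Stieltjes integral of `X : L → ℝ`, the supremum of the lower sums over all finite
partitions of `⊤` contained in `AL`. -/
def lowerIntegral {𝓑 I : Type*} [CompleteAtomicBooleanAlgebra 𝓑] (H : I → 𝓑)
    (AL : BooleanSubalgebra 𝓑) (π : 𝓑 → ℝ) (X : I → ℝ) : ℝ :=
  sSup {s | ∃ p : Finpartition (⊤ : 𝓑), (∀ B ∈ p.parts, B ∈ AL) ∧
    s = ∑ B ∈ p.parts, sInf (X '' {i | H i ≤ B}) * π B}

/-- The upper Stieltjes integral of `X : L → ℝ`. -/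
def upperIntegral {𝓑 I : Type*} [CompleteAtomicBooleanAlgebra 𝓑] (H : I → 𝓑)
    (AL : BooleanSubalgebra 𝓑) (π : 𝓑 → ℝ) (X : I → ℝ) : ℝ :=
  sInf {s | ∃ p : Finpartition (⊤ : 𝓑), (∀ B ∈ p.parts, B ∈ AL) ∧
    s = ∑ B ∈ p.parts, sSup (X '' {i | H i ≤ B}) * π B}

/-- Stieltjes integrability (of a bounded function `X`): the lower and the upper integral
coincide. -/
def IsSIntegrable {𝓑 I : Type*} [CompleteAtomicBooleanAlgebra 𝓑] (H : I → 𝓑)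
    (AL : BooleanSubalgebra 𝓑) (π : 𝓑 → ℝ) (X : I → ℝ) : Prop :=
  lowerIntegral H AL π X = upperIntegral H AL π X

/-- The Stieltjes integral of an S-integrable `X`: the common value of the lower and the upper
integral. -/
def integral {𝓑 I : Type*} [CompleteAtomicBooleanAlgebra 𝓑] (H : I → 𝓑)
    (AL : BooleanSubalgebra 𝓑) (π : 𝓑 → ℝ) (X : I → ℝ) : ℝ :=
  lowerIntegral H AL π X

/-- The event `(X ≥ t)`. -/
def geEvent {𝓑 I : Type*} [CompleteAtomicBooleanAlgebra 𝓑] (H : I → 𝓑) (X : I → ℝ) (t : ℝ) : 𝓑 :=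
  sSup (H '' {i | t ≤ X i})

/-- `X : L → ℝ` is `AL`-continuous. -/
structure IsAlgContinuous {𝓑 I : Type*} [CompleteAtomicBooleanAlgebra 𝓑] (H : I → 𝓑)
    (AL : BooleanSubalgebra 𝓑) (X : I → ℝ) : Prop where
  bounded : ∃ C : ℝ, ∀ i, |X i| ≤ C
  exists_between : ∀ t ε : ℝ, 0 < ε →
    ∃ B ∈ AL, geEvent H X (t + ε) ≤ B ∧ B ≤ geEvent H X t

/-- The `L`-disintegrable joint probability `P^d(F) = ∫ σ(F | H i) π(dH i)`. -/
def disintegrableJoint {𝓑 I : Type*} [CompleteAtomicBooleanAlgebra 𝓑] (H : I → 𝓑)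
    (AL : BooleanSubalgebra 𝓑) (π : 𝓑 → ℝ) (σ : 𝓑 → I → ℝ) (F : 𝓑) : ℝ :=
  integral H AL π (σ F)

/-- The set of full conditional probabilities on `A` that extend `{Pd, σ}`: they agree with `Pd`
on `A × {⊤}` and with `σ` on `A × L`. -/
def extensions {𝓑 I : Type*} [CompleteAtomicBooleanAlgebra 𝓑] (H : I → 𝓑)
    (A : BooleanSubalgebra 𝓑) (Pd : 𝓑 → ℝ) (σ : 𝓑 → I → ℝ) : Set (𝓑 → 𝓑 → ℝ) :=
  {P | IsFullCondProb A P ∧ (∀ F ∈ A, P F ⊤ = Pd F) ∧ ∀ F ∈ A, ∀ i, P F (H i) = σ F i}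

/-- The pointwise lower envelope of a set of (conditional) probabilities. -/
def lowerEnvelope {𝓑 : Type*} (𝓟 : Set (𝓑 → 𝓑 → ℝ)) (F K : 𝓑) : ℝ :=
  sInf ((fun P => P F K) '' 𝓟)

/-- `I₂^{F|K}`: the indices `i` with `H i ∧ F ∧ K ≠ ⊥ ≠ H i ∧ Fᶜ ∧ K`. -/
def I₂ {𝓑 I : Type*} [CompleteAtomicBooleanAlgebra 𝓑] (H : I → 𝓑) (F K : 𝓑) : Set I :=
  {i | H i ⊓ F ⊓ K ≠ ⊥ ∧ H i ⊓ Fᶜ ⊓ K ≠ ⊥}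

/-- `I₃^{F|K}`: the indices `i` with `H i ∧ F ∧ K = ⊥ ≠ H i ∧ Fᶜ ∧ K`. -/
def I₃ {𝓑 I : Type*} [CompleteAtomicBooleanAlgebra 𝓑] (H : I → 𝓑) (F K : 𝓑) : Set I :=
  {i | H i ⊓ F ⊓ K = ⊥ ∧ H i ⊓ Fᶜ ⊓ K ≠ ⊥}

/-- The condition under which the envelope at a conditioning event of probability zero is given
by the minimum of ratios. -/
def RatioCase {𝓑 I : Type*} [CompleteAtomicBooleanAlgebra 𝓑] (H : I → 𝓑) (σ : 𝓑 → I → ℝ)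
    (F K : 𝓑) : Prop :=
  (I₂ H F K).Nonempty ∧ I₃ H F K = ∅ ∧ (I₂ H F K).Finite ∧ ∀ i ∈ I₂ H F K, 0 < σ K i

end Envelope

end

/-!
Lower sums increase along the directed set of refinements, so the lower integral is their limit,
which makes it superadditive. Continuity forces the oscillation of `σ(F | ·)` on the members of a
fine enough partition below any `ε`; hence the upper and the lower integral agree, the integral is
additive, and `P^d` is a finitely additive probability with `P^d(F ∧ H i) = σ(F | H i) P^d(H i)`.

Full conditional probabilities are built by layering finitely additive probabilities: conditioning
on `K` means Bayes' rule for the first layer that charges `K`. Putting `P^d` on top of the layers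
`σ(· | H i)` shows that extensions exist. If `P^d(K) = 0`, a layer inserted just below `P^d`
determines the value at `F | K`. It can be any probability that obeys the product rule with `σ`:
one of the `σ(· | H i)` themselves, possibly followed by the Dirac measure at an atom of
`H i ∧ Fᶜ ∧ K`, or, when infinitely many cells meet `Fᶜ ∧ K`, the `0`-`1` measure of a free
ultrafilter along atoms of these events. This attains the claimed minimum. In the ratio case no
extension goes lower, because finitely many cells cover `Fᶜ ∧ K` and the chain rule bounds
`P(Fᶜ | K)` by a mixture of the values at those cells.
-/

noncomputable section

open Set Filter

namespace Envelope

variable {𝓑 I : Type*} [CompleteAtomicBooleanAlgebra 𝓑] {H : I → 𝓑} {AL A : BooleanSubalgebra 𝓑}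

/-! ### Partitions -/

/-- The algebra of the events that are decided (implied or excluded) by the event `a`. It is
complete, so the cells of a partition decide every event of the complete algebra they generate. -/
def decidedSubalgebra (a : 𝓑) : BooleanSubalgebra 𝓑 where
  carrier := {B | a ≤ B ∨ Disjoint a B}
  supClosed' := by
    rintro B (hB | hB) C (hC | hC)
    · exact Or.inl (hB.trans le_sup_left)
    · exact Or.inl (hB.trans le_sup_left)
    · exact Or.inl (hC.trans le_sup_right)
    · exact Or.inr (hB.sup_right hC)
  infClosed' := by
    rintro B (hB | hB) C (hC | hC)
    · exact Or.inl (le_inf hB hC)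
    · exact Or.inr (hC.mono_right inf_le_right)
    · exact Or.inr (hB.mono_right inf_le_left)
    · exact Or.inr (hB.mono_right inf_le_left)
  compl_mem' := by
    rintro B (hB | hB)
    · exact Or.inr (disjoint_compl_right_iff.2 hB)
    · exact Or.inl hB.le_compl_right
  bot_mem' := Or.inr disjoint_bot_right

lemma mem_decidedSubalgebra {a B : 𝓑} : B ∈ decidedSubalgebra a ↔ a ≤ B ∨ Disjoint a B :=
  Iff.rfl

lemma sSup_mem_decidedSubalgebra {a : 𝓑} {T : Set 𝓑} (hT : T ⊆ decidedSubalgebra a) :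
    sSup T ∈ decidedSubalgebra a := by
  by_cases h : ∃ B ∈ T, a ≤ B
  · obtain ⟨B, hB, haB⟩ := h
    exact Or.inl (haB.trans (le_sSup hB))
  · push Not at h
    exact Or.inr (disjoint_sSup_iff.2 fun B hB => (hT hB).resolve_left (h B hB))

lemma sInf_mem_decidedSubalgebra {a : 𝓑} {T : Set 𝓑} (hT : T ⊆ decidedSubalgebra a) :
    sInf T ∈ decidedSubalgebra a := by
  by_cases h : ∃ B ∈ T, Disjoint a B
  · obtain ⟨B, hB, haB⟩ := h
    exact Or.inr (haB.mono_right (sInf_le hB))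
  · push Not at h
    exact Or.inl (le_sInf fun B hB => (hT hB).resolve_right (h B hB))

/-- The family `H` is dense in the algebra `AL`: every possible event of `AL` is implied by some
`H i`. This keeps the infima in the lower sums of the Stieltjes integral away from the junk value
`sInf ∅ = 0`. -/
def IsDenseIn (H : I → 𝓑) (AL : BooleanSubalgebra 𝓑) : Prop :=
  ∀ B ∈ AL, B ≠ ⊥ → ∃ i, H i ≤ B

namespace IsPartition

lemma completeClosure_le_decidedSubalgebra (hH : IsPartition H) (i : I) :
    completeClosure (range H) ≤ decidedSubalgebra (H i) := by
  refine sInf_le ⟨?_, fun T hT =>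
    ⟨sSup_mem_decidedSubalgebra hT, sInf_mem_decidedSubalgebra hT⟩⟩
  rintro _ ⟨j, rfl⟩
  by_cases hij : i = j
  · exact Or.inl (hij ▸ le_rfl)
  · exact Or.inr (hH.disjoint i j hij)

lemma exists_inf_ne_bot (hH : IsPartition H) {B : 𝓑} (hB : B ≠ ⊥) : ∃ i, H i ⊓ B ≠ ⊥ := by
  by_contra! h
  have hsup : (⨆ i, H i) ⊓ B = ⊥ := by simp only [iSup_inf_eq, h, iSup_bot]
  exact hB (by rwa [hH.iSup_eq_top, top_inf_eq] at hsup)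

lemma le_of_forall_cell_le (hH : IsPartition H) {B D : 𝓑} (h : ∀ i, H i ⊓ B ≠ ⊥ → H i ≤ D) :
    B ≤ D := by
  by_contra hBD
  obtain ⟨i, hi⟩ := hH.exists_inf_ne_bot (mt disjoint_compl_right_iff.1 hBD ∘ disjoint_iff.2)
  refine hi (disjoint_iff.1 (disjoint_compl_right.mono (h i fun hiB => hi ?_) inf_le_right))
  rw [← inf_assoc, hiB, bot_inf_eq]

lemma isDenseIn (hH : IsPartition H) (hAL : AL ≤ completeClosure (range H)) :
    IsDenseIn H AL := by
  intro B hB hB0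
  obtain ⟨i, hi⟩ := hH.exists_inf_ne_bot hB0
  have hdec := mem_decidedSubalgebra.1 (hH.completeClosure_le_decidedSubalgebra i (hAL hB))
  exact ⟨i, hdec.resolve_right fun hd => hi hd.eq_bot⟩

lemma le_of_le_geEvent (hH : IsPartition H) {X : I → ℝ} {t : ℝ} {i : I}
    (hi : H i ≤ geEvent H X t) : t ≤ X i := by
  by_contra h
  refine hH.ne_bot i (disjoint_self.1 (Disjoint.mono_right hi (disjoint_sSup_iff.2 ?_)))
  rintro _ ⟨j, hj, rfl⟩
  exact hH.disjoint i j (by rintro rfl; exact h hj)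

end IsPartition

lemma le_geEvent {X : I → ℝ} {t : ℝ} {i : I} (h : t ≤ X i) : H i ≤ geEvent H X t :=
  le_sSup (mem_image_of_mem _ h)

/-! ### Finitely additive probabilities -/

namespace IsFinAddProb

variable {p : 𝓑 → ℝ} {F G K : 𝓑}

lemma bot (hp : IsFinAddProb A p) : p ⊥ = 0 := by
  have h := hp.sup_of_disjoint ⊥ BooleanSubalgebra.bot_mem ⊥ BooleanSubalgebra.bot_mem
    disjoint_bot_left
  rwa [sup_idem, left_eq_add] at h

lemma mono (hp : IsFinAddProb A p) (hF : F ∈ A) (hG : G ∈ A) (h : F ≤ G) : p F ≤ p G := by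
  have hd := BooleanSubalgebra.sdiff_mem hG hF
  have hadd := hp.sup_of_disjoint F hF (G \ F) hd disjoint_sdiff_self_right
  rw [sup_sdiff_cancel_right h] at hadd
  linarith [hp.nonneg _ hd]

lemma le_one (hp : IsFinAddProb A p) (hF : F ∈ A) : p F ≤ 1 :=
  hp.top ▸ hp.mono hF BooleanSubalgebra.top_mem le_top

lemma eq_zero_of_le (hp : IsFinAddProb A p) (hF : F ∈ A) (hG : G ∈ A) (h : F ≤ G)
    (hG0 : p G = 0) : p F = 0 :=
  le_antisymm (hG0 ▸ hp.mono hF hG h) (hp.nonneg F hF)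

lemma inf_add_inf_compl (hp : IsFinAddProb A p) (hF : F ∈ A) (hK : K ∈ A) :
    p (F ⊓ K) + p (Fᶜ ⊓ K) = p K := by
  rw [← hp.sup_of_disjoint _ (BooleanSubalgebra.inf_mem hF hK) _
    (BooleanSubalgebra.inf_mem (BooleanSubalgebra.compl_mem hF) hK)
    (disjoint_compl_right.mono inf_le_left inf_le_left), ← inf_sup_right, sup_compl_eq_top,
    top_inf_eq]

lemma add_compl (hp : IsFinAddProb A p) (hF : F ∈ A) : p F + p Fᶜ = 1 := by
  simpa only [inf_top_eq, hp.top] using hp.inf_add_inf_compl hF BooleanSubalgebra.top_mem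

lemma inf_of_eq_one (hp : IsFinAddProb A p) (hF : F ∈ A) (hG : G ∈ A) (hG1 : p G = 1) :
    p (F ⊓ G) = p F := by
  have hGc := BooleanSubalgebra.compl_mem hG
  have hnull : p (Gᶜ ⊓ F) = 0 :=
    hp.eq_zero_of_le (BooleanSubalgebra.inf_mem hGc hF) hGc inf_le_left
      (by linarith [hp.add_compl hG])
  rw [← hp.inf_add_inf_compl hG hF, hnull, add_zero, inf_comm]

lemma inf_finset_sup (hp : IsFinAddProb A p) {ι : Type*} {s : Finset ι} {f : ι → 𝓑}
    (hF : F ∈ A) (hf : ∀ i ∈ s, f i ∈ A) (hd : (s : Set ι).PairwiseDisjoint f) :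
    p (F ⊓ s.sup f) = ∑ i ∈ s, p (F ⊓ f i) := by
  classical
  induction s using Finset.induction_on with
  | empty => simp only [Finset.sup_empty, inf_bot_eq, hp.bot, Finset.sum_empty]
  | insert i s hi ih =>
    rw [Finset.forall_mem_insert] at hf
    rw [Finset.coe_insert, pairwiseDisjoint_insert_of_notMem (by simpa using hi)] at hd
    have hdis : Disjoint (f i) (s.sup f) := Finset.disjoint_sup_right.2 hd.2
    have hsup : s.sup f ∈ A :=
      Finset.sup_mem A BooleanSubalgebra.bot_mem (fun _ h _ => BooleanSubalgebra.sup_mem h) s f hf.2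
    rw [Finset.sum_insert hi, Finset.sup_insert, inf_sup_left, ← ih hf.2 hd.1]
    exact hp.sup_of_disjoint _ (BooleanSubalgebra.inf_mem hF hf.1) _
      (BooleanSubalgebra.inf_mem hF hsup) (hdis.mono inf_le_right inf_le_right)

lemma sum_inf_parts (hp : IsFinAddProb A p) (hF : F ∈ A) {P : Finpartition (⊤ : 𝓑)}
    (hP : ∀ B ∈ P.parts, B ∈ A) : ∑ B ∈ P.parts, p (F ⊓ B) = p F := by
  have h := hp.inf_finset_sup (f := id) hF hP P.disjoint
  rwa [P.sup_parts, inf_top_eq, eq_comm] at h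

lemma sum_parts (hp : IsFinAddProb A p) {P : Finpartition (⊤ : 𝓑)}
    (hP : ∀ B ∈ P.parts, B ∈ A) : ∑ B ∈ P.parts, p B = 1 := by
  simpa only [top_inf_eq, hp.top] using hp.sum_inf_parts BooleanSubalgebra.top_mem hP

/-- Both sums are sums over the pairs of parts, and pairs with disjoint parts have weight zero. -/
lemma sum_mul_le_sum_mul (hp : IsFinAddProb A p) {P Q : Finpartition (⊤ : 𝓑)}
    (hP : ∀ B ∈ P.parts, B ∈ A) (hQ : ∀ C ∈ Q.parts, C ∈ A) {x y : 𝓑 → ℝ}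
    (hxy : ∀ B ∈ P.parts, ∀ C ∈ Q.parts, B ⊓ C ≠ ⊥ → x B ≤ y C) :
    ∑ B ∈ P.parts, x B * p B ≤ ∑ C ∈ Q.parts, y C * p C := by
  calc ∑ B ∈ P.parts, x B * p B
      = ∑ B ∈ P.parts, ∑ C ∈ Q.parts, x B * p (B ⊓ C) :=
        Finset.sum_congr rfl fun B hB => by rw [← Finset.mul_sum, hp.sum_inf_parts (hP B hB) hQ]
    _ ≤ ∑ B ∈ P.parts, ∑ C ∈ Q.parts, y C * p (B ⊓ C) := by
        refine Finset.sum_le_sum fun B hB => Finset.sum_le_sum fun C hC => ?_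
        by_cases hBC : B ⊓ C = ⊥
        · rw [hBC, hp.bot, mul_zero, mul_zero]
        · exact mul_le_mul_of_nonneg_right (hxy B hB C hC hBC)
            (hp.nonneg _ (BooleanSubalgebra.inf_mem (hP B hB) (hQ C hC)))
    _ = ∑ C ∈ Q.parts, ∑ B ∈ P.parts, y C * p (C ⊓ B) := by
        rw [Finset.sum_comm]
        simp only [inf_comm]
    _ = ∑ C ∈ Q.parts, y C * p C :=
        Finset.sum_congr rfl fun C hC => by rw [← Finset.mul_sum, hp.sum_inf_parts (hQ C hC) hP]

end IsFinAddProb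

/-! ### The Stieltjes integral -/

/-- The finite partitions of the sure event contained in `AL`, ordered by refinement: finer
partitions are smaller. -/
abbrev AlgPartition (AL : BooleanSubalgebra 𝓑) : Type _ :=
  {p : Finpartition (⊤ : 𝓑) // ∀ B ∈ p.parts, B ∈ AL}

namespace AlgPartition

open Classical in
instance : Nonempty (AlgPartition AL) :=
  ⟨⊤, fun B hB => by
    rw [Finset.mem_singleton.1 (Finpartition.parts_top_subset _ hB)]
    exact BooleanSubalgebra.top_mem⟩

open Classical in
instance : SemilatticeInf (AlgPartition AL) :=
  Subtype.semilatticeInf fun p q hp hq B hB => by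
    rw [Finpartition.parts_inf, Finset.mem_erase, Finset.mem_image] at hB
    obtain ⟨-, ⟨C, D⟩, hCD, rfl⟩ := hB
    rw [Finset.mem_product] at hCD
    exact BooleanSubalgebra.inf_mem (hp C hCD.1) (hq D hCD.2)

lemma eventually_le_or_le_compl {B : 𝓑} (hB : B ∈ AL) :
    ∀ᶠ p : AlgPartition AL in atBot, ∀ C ∈ p.1.parts, C ≤ B ∨ C ≤ Bᶜ := by
  classical
  have hd : (({B, Bᶜ} : Finset 𝓑) : Set 𝓑).PairwiseDisjoint id := by
    rw [Finset.coe_pair]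
    exact pairwise_pair.2 fun _ => ⟨disjoint_compl_right, disjoint_compl_left⟩
  let q : AlgPartition AL := ⟨Finpartition.ofErase {B, Bᶜ}
    (Finset.supIndep_iff_pairwiseDisjoint.2 hd) (by simp), fun C hC => by
      have hC' := Finset.mem_of_mem_erase hC
      rw [Finset.mem_insert, Finset.mem_singleton] at hC'
      rcases hC' with rfl | rfl
      · exact hB
      · exact BooleanSubalgebra.compl_mem hB⟩
  filter_upwards [eventually_le_atBot q] with p hpq C hC
  obtain ⟨D, hD, hCD⟩ := hpq hC
  have hD' := Finset.mem_of_mem_erase hD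
  rw [Finset.mem_insert, Finset.mem_singleton] at hD'
  rcases hD' with rfl | rfl
  · exact Or.inl hCD
  · exact Or.inr hCD

end AlgPartition

section Integral

variable {π : 𝓑 → ℝ} {X Y : I → ℝ} {B : 𝓑}

/-- The infimum of `X` over the cells that imply `B`, that is `inf_{H i ⊆ B} X i`. -/
def cellInf (H : I → 𝓑) (X : I → ℝ) (B : 𝓑) : ℝ :=
  sInf (X '' {i | H i ≤ B})

/-- The lower sum of the Stieltjes integral of `X` for the partition `p`. -/
def lowerSum (H : I → 𝓑) (π : 𝓑 → ℝ) (X : I → ℝ) (p : AlgPartition AL) : ℝ :=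
  ∑ B ∈ p.1.parts, cellInf H X B * π B

lemma lowerIntegral_eq_iSup (H : I → 𝓑) (AL : BooleanSubalgebra 𝓑) (π : 𝓑 → ℝ) (X : I → ℝ) :
    lowerIntegral H AL π X = ⨆ p : AlgPartition AL, lowerSum H π X p := by
  refine congrArg sSup (Set.ext fun s => ⟨?_, ?_⟩)
  · rintro ⟨p, hp, rfl⟩
    exact ⟨⟨p, hp⟩, rfl⟩
  · rintro ⟨⟨p, hp⟩, rfl⟩
    exact ⟨p, hp, rfl⟩

lemma upperIntegral_eq_neg_lowerIntegral_neg (H : I → 𝓑) (AL : BooleanSubalgebra 𝓑) (π : 𝓑 → ℝ)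
    (X : I → ℝ) : upperIntegral H AL π X = -lowerIntegral H AL π (-X) := by
  have hinf : ∀ B, sInf ((-X) '' {i | H i ≤ B}) = -sSup (X '' {i | H i ≤ B}) := fun B => by
    rw [← Real.sInf_neg, ← image_neg_eq_neg, image_image]
    rfl
  rw [upperIntegral, lowerIntegral, ← Real.sInf_neg]
  congr 1
  ext s
  simp only [hinf, neg_mul, Finset.sum_neg_distrib, Set.mem_neg, mem_ofPred_eq, neg_inj]

lemma isSIntegrable_iff : IsSIntegrable H AL π X ↔
    lowerIntegral H AL π (-X) = -lowerIntegral H AL π X := by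
  rw [IsSIntegrable, upperIntegral_eq_neg_lowerIntegral_neg, eq_neg_iff_add_eq_zero,
    eq_neg_iff_add_eq_zero, add_comm]

lemma bddBelow_image_of_abs_le (hX : ∃ C, ∀ i, |X i| ≤ C) (s : Set I) : BddBelow (X '' s) := by
  obtain ⟨C, hC⟩ := hX
  refine ⟨-C, ?_⟩
  rintro _ ⟨i, -, rfl⟩
  exact (abs_le.1 (hC i)).1

lemma exists_abs_neg_le (hX : ∃ C, ∀ i, |X i| ≤ C) : ∃ C, ∀ i, |(-X) i| ≤ C := by
  simpa only [Pi.neg_apply, abs_neg] using hX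

lemma exists_abs_add_le (hX : ∃ C, ∀ i, |X i| ≤ C) (hY : ∃ C, ∀ i, |Y i| ≤ C) :
    ∃ C, ∀ i, |(X + Y) i| ≤ C := by
  obtain ⟨C, hC⟩ := hX
  obtain ⟨D, hD⟩ := hY
  exact ⟨C + D, fun i => (abs_add_le _ _).trans (add_le_add (hC i) (hD i))⟩

lemma cellInf_le (hX : ∃ C, ∀ i, |X i| ≤ C) {i : I} (hi : H i ≤ B) : cellInf H X B ≤ X i :=
  csInf_le (bddBelow_image_of_abs_le hX _) (mem_image_of_mem X hi)

lemma le_cellInf (hAL : IsDenseIn H AL) (hB : B ∈ AL) (hB0 : B ≠ ⊥) {c : ℝ}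
    (h : ∀ i, H i ≤ B → c ≤ X i) : c ≤ cellInf H X B := by
  obtain ⟨i, hi⟩ := hAL B hB hB0
  exact le_csInf ⟨X i, mem_image_of_mem X hi⟩ (forall_mem_image.2 fun j hj => h j hj)

lemma lowerSum_antitone (hAL : IsDenseIn H AL) (hπ : IsFinAddProb AL π)
    (hX : ∃ C, ∀ i, |X i| ≤ C) : Antitone (lowerSum (AL := AL) H π X) := by
  intro p q hpq
  refine hπ.sum_mul_le_sum_mul q.2 p.2 fun B hB C hC hBC => ?_
  obtain ⟨D, hD, hCD⟩ := hpq hC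
  have hDB : D = B := q.1.disjoint.elim hD hB fun h =>
    hBC (h.mono_left hCD).symm.eq_bot
  exact le_cellInf hAL (p.2 C hC) (p.1.ne_bot hC) fun i hi =>
    cellInf_le hX (hi.trans (hDB ▸ hCD))

lemma lowerSum_le_of_le (hAL : IsDenseIn H AL) (hπ : IsFinAddProb AL π)
    (hX : ∃ C, ∀ i, |X i| ≤ C) {c : ℝ} (hc : ∀ i, X i ≤ c) (p : AlgPartition AL) :
    lowerSum H π X p ≤ c := by
  calc lowerSum H π X p ≤ ∑ B ∈ p.1.parts, c * π B := by
        refine Finset.sum_le_sum fun B hB => mul_le_mul_of_nonneg_right ?_ (hπ.nonneg B (p.2 B hB))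
        obtain ⟨i, hi⟩ := hAL B (p.2 B hB) (p.1.ne_bot hB)
        exact (cellInf_le hX hi).trans (hc i)
    _ = c := by rw [← Finset.mul_sum, hπ.sum_parts p.2, mul_one]

lemma tendsto_lowerSum (hAL : IsDenseIn H AL) (hπ : IsFinAddProb AL π)
    (hX : ∃ C, ∀ i, |X i| ≤ C) :
    Tendsto (lowerSum (AL := AL) H π X) atBot (nhds (lowerIntegral H AL π X)) := by
  obtain ⟨C, hC⟩ := id hX
  rw [lowerIntegral_eq_iSup]
  exact tendsto_atBot_ciSup (lowerSum_antitone hAL hπ hX)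
    ⟨C, forall_mem_range.2 (lowerSum_le_of_le hAL hπ hX fun i => (abs_le.1 (hC i)).2)⟩

lemma lowerSum_add_le (hAL : IsDenseIn H AL) (hπ : IsFinAddProb AL π)
    (hX : ∃ C, ∀ i, |X i| ≤ C) (hY : ∃ C, ∀ i, |Y i| ≤ C) (p : AlgPartition AL) :
    lowerSum H π X p + lowerSum H π Y p ≤ lowerSum H π (X + Y) p := by
  rw [lowerSum, lowerSum, lowerSum, ← Finset.sum_add_distrib]
  refine Finset.sum_le_sum fun B hB => ?_
  rw [← add_mul]
  refine mul_le_mul_of_nonneg_right ?_ (hπ.nonneg B (p.2 B hB))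
  exact le_cellInf hAL (p.2 B hB) (p.1.ne_bot hB) fun i hi =>
    add_le_add (cellInf_le hX hi) (cellInf_le hY hi)

lemma lowerIntegral_add_le (hAL : IsDenseIn H AL) (hπ : IsFinAddProb AL π)
    (hX : ∃ C, ∀ i, |X i| ≤ C) (hY : ∃ C, ∀ i, |Y i| ≤ C) :
    lowerIntegral H AL π X + lowerIntegral H AL π Y ≤ lowerIntegral H AL π (X + Y) :=
  le_of_tendsto_of_tendsto'
    ((tendsto_lowerSum hAL hπ hX).add (tendsto_lowerSum hAL hπ hY))
    (tendsto_lowerSum hAL hπ (exists_abs_add_le hX hY)) (lowerSum_add_le hAL hπ hX hY)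

lemma lowerIntegral_const (hAL : IsDenseIn H AL) (hπ : IsFinAddProb AL π) (c : ℝ) :
    lowerIntegral H AL π (fun _ => c) = c := by
  have hsum : ∀ p : AlgPartition AL, lowerSum H π (fun _ => c) p = c := fun p =>
    calc lowerSum H π (fun _ => c) p = ∑ B ∈ p.1.parts, c * π B := by
          refine Finset.sum_congr rfl fun B hB => ?_
          have hne : {i | H i ≤ B}.Nonempty := hAL B (p.2 B hB) (p.1.ne_bot hB)
          rw [cellInf, hne.image_const, csInf_singleton]
      _ = c := by rw [← Finset.mul_sum, hπ.sum_parts p.2, mul_one]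
  rw [lowerIntegral_eq_iSup]
  simp only [hsum, ciSup_const]

lemma lowerIntegral_nonneg (hπ : IsFinAddProb AL π) (hX : ∀ i, 0 ≤ X i) :
    0 ≤ lowerIntegral H AL π X := by
  rw [lowerIntegral_eq_iSup]
  exact Real.iSup_nonneg fun p => Finset.sum_nonneg fun B hB =>
    mul_nonneg (Real.sInf_nonneg (forall_mem_image.2 fun i _ => hX i)) (hπ.nonneg B (p.2 B hB))

lemma lowerIntegral_const_mul (H : I → 𝓑) (AL : BooleanSubalgebra 𝓑) (π : 𝓑 → ℝ) (X : I → ℝ)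
    {c : ℝ} (hc : 0 ≤ c) :
    lowerIntegral H AL π (fun i => c * X i) = c * lowerIntegral H AL π X := by
  have hinf : ∀ B, cellInf H (fun i => c * X i) B = c * cellInf H X B := fun B => by
    rw [cellInf, cellInf, ← smul_eq_mul, ← Real.sInf_smul_of_nonneg hc, ← image_smul, image_image]
    rfl
  simp only [lowerIntegral_eq_iSup, Real.mul_iSup_of_nonneg hc, lowerSum, hinf, mul_assoc,
    Finset.mul_sum]

/-- The lower integral is superadditive; for the converse inequality, move `Y` to the other
side. -/
lemma IsSIntegrable.lowerIntegral_add (hAL : IsDenseIn H AL) (hπ : IsFinAddProb AL π)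
    (hX : ∃ C, ∀ i, |X i| ≤ C) (hY : ∃ C, ∀ i, |Y i| ≤ C) (hint : IsSIntegrable H AL π Y) :
    lowerIntegral H AL π (X + Y) = lowerIntegral H AL π X + lowerIntegral H AL π Y := by
  refine le_antisymm ?_ (lowerIntegral_add_le hAL hπ hX hY)
  have h := lowerIntegral_add_le hAL hπ (exists_abs_add_le hX hY) (exists_abs_neg_le hY)
  rw [add_neg_cancel_right, isSIntegrable_iff.1 hint] at h
  linarith

end Integral

namespace IsAlgContinuous

variable {π : 𝓑 → ℝ} {X : I → ℝ} {ε : ℝ}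

/-- Two values more than `ε` apart are separated by an interval `[t, t + ε / 4]` with `t` in a
finite `ε / 4`-net of the range, so it is enough to refine a separating event of `AL` for each `t`
in the net. -/
lemma eventually_le_add (hH : IsPartition H) (hX : IsAlgContinuous H AL X) (hε : 0 < ε) :
    ∀ᶠ p : AlgPartition AL in atBot, ∀ B ∈ p.1.parts, ∀ i j, H i ≤ B → H j ≤ B →
      X i ≤ X j + ε := by
  obtain ⟨C, hC⟩ := hX.bounded
  obtain ⟨T, -, hT, hnet⟩ :=
    finite_cover_balls_of_compact (isCompact_Icc (a := -C) (b := C)) (e := ε / 4) (by positivity)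
  choose S hS hgeS hSge using fun t => hX.exists_between t (ε / 4) (by positivity)
  have hev := hT.eventually_all.2 fun t _ => AlgPartition.eventually_le_or_le_compl (hS t)
  filter_upwards [hev] with p hp B hB i j hi hj
  by_contra! hlt
  have hCi := abs_le.1 (hC i)
  have hCj := abs_le.1 (hC j)
  obtain ⟨t, ht, hmid⟩ := mem_iUnion₂.1
    (hnet (show (X i + X j) / 2 ∈ Icc (-C) C from ⟨by linarith, by linarith⟩))
  rw [Metric.mem_ball, Real.dist_eq, abs_lt] at hmid
  have hiS : H i ≤ S t := (le_geEvent (by linarith)).trans (hgeS t)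
  have hBS : B ≤ S t := (hp t ht B hB).resolve_right fun h =>
    hH.ne_bot i (disjoint_self.1 (disjoint_compl_right.mono hiS (hi.trans h)))
  linarith [hH.le_of_le_geEvent ((hj.trans hBS).trans (hSge t))]

lemma isSIntegrable (hH : IsPartition H) (hAL : IsDenseIn H AL) (hπ : IsFinAddProb AL π)
    (hX : IsAlgContinuous H AL X) : IsSIntegrable H AL π X := by
  have hnegb := exists_abs_neg_le hX.bounded
  have hle : lowerIntegral H AL π X + lowerIntegral H AL π (-X) ≤ 0 := by
    have h := lowerIntegral_add_le hAL hπ hX.bounded hnegb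
    rw [add_neg_cancel] at h
    exact h.trans_eq (lowerIntegral_const hAL hπ 0)
  have hge : ∀ ε > 0, -ε ≤ lowerIntegral H AL π X + lowerIntegral H AL π (-X) := by
    intro ε hε
    refine ge_of_tendsto ((tendsto_lowerSum hAL hπ hX.bounded).add
      (tendsto_lowerSum hAL hπ hnegb)) ?_
    filter_upwards [hX.eventually_le_add hH hε] with p hp
    calc -ε = ∑ B ∈ p.1.parts, -ε * π B := by rw [← Finset.mul_sum, hπ.sum_parts p.2, mul_one]
      _ ≤ ∑ B ∈ p.1.parts, (cellInf H X B + cellInf H (-X) B) * π B := by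
          refine Finset.sum_le_sum fun B hB =>
            mul_le_mul_of_nonneg_right ?_ (hπ.nonneg B (p.2 B hB))
          have hB0 := p.1.ne_bot hB
          rw [← sub_le_iff_le_add]
          refine le_cellInf hAL (p.2 B hB) hB0 fun i hi => ?_
          rw [sub_le_comm]
          refine le_cellInf hAL (p.2 B hB) hB0 fun j hj => ?_
          rw [Pi.neg_apply]
          linarith [hp B hB j i hj hi]
      _ = lowerSum H π X p + lowerSum H π (-X) p := by
          simp only [lowerSum, add_mul, Finset.sum_add_distrib]
  rw [isSIntegrable_iff, eq_neg_iff_add_eq_zero, add_comm]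
  exact le_antisymm hle (le_of_forall_pos_le_add fun ε hε => by linarith [hge ε hε])

end IsAlgContinuous

/-! ### Strategies and compatible probabilities -/

variable {σ : 𝓑 → I → ℝ} {F K : 𝓑}

namespace IsStrategy

lemma self (hσ : IsStrategy H A σ) (hHA : ∀ i, H i ∈ A) (i : I) : σ (H i) i = 1 :=
  hσ.eq_one i _ (hHA i) (inf_idem _)

lemma inf_self (hσ : IsStrategy H A σ) (hHA : ∀ i, H i ∈ A) (hF : F ∈ A) (i : I) :
    σ (F ⊓ H i) i = σ F i :=
  (hσ.finAddProb i).inf_of_eq_one hF (hHA i) (hσ.self hHA i)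

lemma of_disjoint (hσ : IsStrategy H A σ) (hHA : ∀ i, H i ∈ A) (hF : F ∈ A) {i : I}
    (h : Disjoint F (H i)) : σ F i = 0 := by
  rw [← hσ.inf_self hHA hF, h.eq_bot]
  exact (hσ.finAddProb i).bot

end IsStrategy

/-- `μ` is a finitely additive probability on `A` that is compatible with the strategy `σ`: the
product rule `μ(F ∧ H i) = σ(F | H i) μ(H i)` holds, so that Bayes' rule for `μ` gives back
`σ(· | H i)` whenever `μ(H i) > 0`. -/
structure IsCompatible (H : I → 𝓑) (A : BooleanSubalgebra 𝓑) (σ : 𝓑 → I → ℝ) (μ : 𝓑 → ℝ) : Prop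
    extends IsFinAddProb A μ where
  inf_eq_mul : ∀ F ∈ A, ∀ i, μ (F ⊓ H i) = σ F i * μ (H i)

lemma IsFinAddProb.isCompatible_of_null {μ : 𝓑 → ℝ} (hμ : IsFinAddProb A μ)
    (hHA : ∀ i, H i ∈ A) (hnull : ∀ i, μ (H i) = 0) : IsCompatible H A σ μ where
  toIsFinAddProb := hμ
  inf_eq_mul F hF i := by
    rw [hnull, mul_zero]
    exact hμ.eq_zero_of_le (BooleanSubalgebra.inf_mem hF (hHA i)) (hHA i) inf_le_right (hnull i)

lemma IsStrategy.isCompatible (hσ : IsStrategy H A σ) (hH : IsPartition H) (hHA : ∀ i, H i ∈ A)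
    (i : I) : IsCompatible H A σ (fun F => σ F i) where
  toIsFinAddProb := hσ.finAddProb i
  inf_eq_mul F hF j := by
    by_cases hij : i = j
    · subst hij
      rw [hσ.inf_self hHA hF, hσ.self hHA, mul_one]
    · rw [hσ.of_disjoint hHA (BooleanSubalgebra.inf_mem hF (hHA j))
          ((hH.disjoint j i (Ne.symm hij)).mono_left inf_le_right),
        hσ.of_disjoint hHA (hHA j) (hH.disjoint j i (Ne.symm hij)), mul_zero]

lemma isCompatible_disintegrableJoint {π : 𝓑 → ℝ} (hH : IsPartition H) (hAL : IsDenseIn H AL)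
    (hHA : ∀ i, H i ∈ A) (hπ : IsFinAddProb AL π) (hσ : IsStrategy H A σ)
    (hcont : ∀ F ∈ A, IsAlgContinuous H AL (σ F)) :
    IsCompatible H A σ (disintegrableJoint H AL π σ) where
  nonneg F hF := lowerIntegral_nonneg hπ fun i => (hσ.finAddProb i).nonneg F hF
  top := by
    have hσtop : σ ⊤ = fun _ => 1 := funext fun i => (hσ.finAddProb i).top
    rw [disintegrableJoint, hσtop]
    exact lowerIntegral_const hAL hπ 1
  sup_of_disjoint F hF G hG hFG := by
    have hσsup : σ (F ⊔ G) = σ F + σ G :=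
      funext fun i => (hσ.finAddProb i).sup_of_disjoint F hF G hG hFG
    rw [disintegrableJoint, hσsup]
    exact ((hcont G hG).isSIntegrable hH hAL hπ).lowerIntegral_add hAL hπ (hcont F hF).bounded
      (hcont G hG).bounded
  inf_eq_mul F hF i := by
    have hσinf : σ (F ⊓ H i) = fun j => σ F i * σ (H i) j :=
      funext fun j => (hσ.isCompatible hH hHA j).inf_eq_mul F hF i
    rw [disintegrableJoint, hσinf]
    exact lowerIntegral_const_mul H AL π (σ (H i)) ((hσ.finAddProb i).nonneg F hF)

/-! ### Full conditional probabilities -/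

/-- The conditional probability of `F` given `K` obtained from `μ` by Bayes' rule; it has the junk
value `0` when `μ K = 0`. -/
def bayes (μ : 𝓑 → ℝ) (F K : 𝓑) : ℝ :=
  μ (F ⊓ K) / μ K

lemma IsFinAddProb.isFinAddProb_bayes {μ : 𝓑 → ℝ} (hμ : IsFinAddProb A μ) (hK : K ∈ A)
    (hpos : 0 < μ K) : IsFinAddProb A (fun F => bayes μ F K) where
  nonneg F hF := div_nonneg (hμ.nonneg _ (BooleanSubalgebra.inf_mem hF hK)) hpos.le
  top := by rw [bayes, top_inf_eq, div_self hpos.ne']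
  sup_of_disjoint F hF G hG hFG := by
    rw [bayes, bayes, bayes, ← add_div, inf_sup_right,
      hμ.sup_of_disjoint _ (BooleanSubalgebra.inf_mem hF hK) _ (BooleanSubalgebra.inf_mem hG hK)
        (hFG.mono inf_le_left inf_le_left)]

lemma isFullCondProb_of_forall_exists_bayes {P : 𝓑 → 𝓑 → ℝ}
    (h : ∀ K ∈ A, K ≠ ⊥ → ∃ μ, IsFinAddProb A μ ∧ 0 < μ K ∧
      ∀ L ∈ A, L ≤ K → 0 < μ L → ∀ F ∈ A, P F L = bayes μ F L) :
    IsFullCondProb A P where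
  inf_self F hF K hK hK0 := by
    obtain ⟨μ, -, hpos, hP⟩ := h K hK hK0
    rw [hP K hK le_rfl hpos F hF, hP K hK le_rfl hpos _ (BooleanSubalgebra.inf_mem hF hK), bayes,
      bayes, inf_assoc, inf_idem]
  finAddProb K hK hK0 := by
    obtain ⟨μ, hμ, hpos, hP⟩ := h K hK hK0
    have hbayes := hμ.isFinAddProb_bayes hK hpos
    have hPK := hP K hK le_rfl hpos
    refine ⟨fun F hF => ?_, ?_, fun F hF G hG hFG => ?_⟩
    · rw [hPK F hF]
      exact hbayes.nonneg F hF
    · rw [hPK ⊤ BooleanSubalgebra.top_mem]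
      exact hbayes.top
    · rw [hPK F hF, hPK G hG, hPK _ (BooleanSubalgebra.sup_mem hF hG)]
      exact hbayes.sup_of_disjoint F hF G hG hFG
  chain E hE F hF K hK hK0 _ := by
    obtain ⟨μ, hμ, hpos, hP⟩ := h K hK hK0
    have hEK := BooleanSubalgebra.inf_mem hE hK
    have hEF := BooleanSubalgebra.inf_mem hE hF
    rw [hP K hK le_rfl hpos _ hEF, hP K hK le_rfl hpos E hE, bayes, bayes]
    rcases (hμ.nonneg _ hEK).eq_or_lt with hzero | hpos'
    · rw [← hzero, hμ.eq_zero_of_le (BooleanSubalgebra.inf_mem hEF hK) hEK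
        (inf_le_inf_right K inf_le_left) hzero.symm, zero_div, zero_mul]
    · rw [hP _ hEK inf_le_right hpos' F hF, bayes, ← inf_assoc, inf_comm F E]
      field_simp

namespace IsFullCondProb

variable {P : 𝓑 → 𝓑 → ℝ} {L : 𝓑}

lemma eq_bayes (hP : IsFullCondProb A P) (hF : F ∈ A) (hL : L ∈ A) (hK : K ∈ A) (hK0 : K ≠ ⊥)
    (hpos : 0 < P L K) : P F (L ⊓ K) = bayes (fun G => P G K) F L := by
  have hLK : L ⊓ K ≠ ⊥ := fun h => by
    rw [hP.inf_self L hL K hK hK0, h, (hP.finAddProb K hK hK0).bot] at hpos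
    exact hpos.false
  rw [bayes, inf_comm F L, hP.chain L hL F hF K hK hK0 hLK, mul_div_cancel_left₀ _ hpos.ne']

lemma self (hP : IsFullCondProb A P) (hK : K ∈ A) (hK0 : K ≠ ⊥) : P K K = 1 := by
  have h := hP.inf_self ⊤ BooleanSubalgebra.top_mem K hK hK0
  rw [top_inf_eq] at h
  exact h.symm.trans (hP.finAddProb K hK hK0).top

lemma eq_one (hP : IsFullCondProb A P) (hF : F ∈ A) (hK : K ∈ A) (hK0 : K ≠ ⊥)
    (h : F ⊓ K = K) : P F K = 1 := by
  rw [hP.inf_self F hF K hK hK0, h, hP.self hK hK0]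

/-- By the chain rule, `P(Fᶜ | K)` is the sum of the terms `P(f i | K) P(Fᶜ | f i ∧ K)`. -/
lemma le_of_forall_le (hP : IsFullCondProb A P) (hF : F ∈ A) (hK : K ∈ A) (hK0 : K ≠ ⊥)
    {ι : Type*} {s : Finset ι} {f : ι → 𝓑} (hf : ∀ i ∈ s, f i ∈ A)
    (hd : (s : Set ι).PairwiseDisjoint f) (hcov : Fᶜ ⊓ K ≤ s.sup f)
    (hne : ∀ i ∈ s, f i ⊓ K ≠ ⊥) {m : ℝ} (hm1 : m ≤ 1)
    (hm : ∀ i ∈ s, m ≤ P F (f i ⊓ K)) : m ≤ P F K := by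
  have hPK := hP.finAddProb K hK hK0
  have hFc := BooleanSubalgebra.compl_mem hF
  have hsup : s.sup f ∈ A :=
    Finset.sup_mem A BooleanSubalgebra.bot_mem (fun _ h _ => BooleanSubalgebra.sup_mem h) s f hf
  have hcell : ∀ i ∈ s, P (Fᶜ ⊓ f i) K ≤ (1 - m) * P (⊤ ⊓ f i) K := by
    intro i hi
    have hPi := hP.finAddProb _ (BooleanSubalgebra.inf_mem (hf i hi) hK) (hne i hi)
    rw [inf_comm, hP.chain _ (hf i hi) _ hFc K hK hK0 (hne i hi), top_inf_eq, mul_comm]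
    refine mul_le_mul_of_nonneg_right ?_ (hPK.nonneg _ (hf i hi))
    linarith [hPi.add_compl hF, hm i hi]
  have hcompl : P Fᶜ K ≤ 1 - m :=
    calc P Fᶜ K = P (Fᶜ ⊓ s.sup f) K := by
          rw [hP.inf_self _ hFc K hK hK0,
            hP.inf_self _ (BooleanSubalgebra.inf_mem hFc hsup) K hK hK0, inf_right_comm,
            inf_eq_left.2 hcov]
      _ = ∑ i ∈ s, P (Fᶜ ⊓ f i) K := hPK.inf_finset_sup hFc hf hd
      _ ≤ ∑ i ∈ s, (1 - m) * P (⊤ ⊓ f i) K := Finset.sum_le_sum hcell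
      _ = (1 - m) * P (⊤ ⊓ s.sup f) K := by
          rw [← Finset.mul_sum, hPK.inf_finset_sup BooleanSubalgebra.top_mem hf hd]
      _ ≤ 1 - m := by
          rw [top_inf_eq]
          exact mul_le_of_le_one_right (sub_nonneg.2 hm1) (hPK.le_one hsup)
  linarith [hPK.add_compl hF]

end IsFullCondProb

/-! ### Layered conditional probabilities -/

open Classical in
/-- The conditional probability that a family `μ` of probabilities (layers), well-ordered by `r`,
induces: Bayes' rule for the first layer that charges the conditioning event; it has the junk value
`0` when no layer does. -/
def lexBayes {Λ : Type*} (r : Λ → Λ → Prop) [IsWellFounded Λ r] (μ : Λ → 𝓑 → ℝ) (F K : 𝓑) : ℝ :=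
  if h : {l | 0 < μ l K}.Nonempty then bayes (μ ((IsWellFounded.wf (r := r)).min _ h)) F K else 0

section LexBayes

variable {Λ : Type*} {r : Λ → Λ → Prop} [IsWellOrder Λ r] {μ : Λ → 𝓑 → ℝ} {l : Λ}

lemma lexBayes_eq (hl : 0 < μ l K) (hmin : ∀ m, r m l → ¬ 0 < μ m K) :
    lexBayes r μ F K = bayes (μ l) F K := by
  have hwf : WellFounded r := IsWellFounded.wf
  have h : {m | 0 < μ m K}.Nonempty := ⟨l, hl⟩
  have hfirst : hwf.min _ h = l := Std.Trichotomous.trichotomous (r := r) _ _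
    (fun hlt => hmin _ hlt (hwf.min_mem _ h)) (hwf.not_lt_min {m | 0 < μ m K} hl)
  rw [lexBayes, dif_pos h, hfirst]

lemma isFullCondProb_lexBayes (hμ : ∀ l, IsFinAddProb A (μ l))
    (hpos : ∀ K ∈ A, K ≠ ⊥ → ∃ l, 0 < μ l K) : IsFullCondProb A (lexBayes r μ) := by
  refine isFullCondProb_of_forall_exists_bayes fun K hK hK0 => ?_
  obtain ⟨l, hl, hmin⟩ := (IsWellFounded.wf (r := r)).has_min {l | 0 < μ l K} (hpos K hK hK0)
  exact ⟨μ l, hμ l, hl, fun L hL hLK hLpos F _ => lexBayes_eq hLpos fun m hm hmL =>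
    hmin m (hmL.trans_le ((hμ m).mono hL hK hLK)) hm⟩

end LexBayes

open Classical in
/-- The conditional probability that follows Bayes' rule for `μ` on the conditioning events
charged by `μ`, and `Q` on the other ones. -/
def prependLayer (μ : 𝓑 → ℝ) (Q : 𝓑 → 𝓑 → ℝ) (F K : 𝓑) : ℝ :=
  if 0 < μ K then bayes μ F K else Q F K

section PrependLayer

variable {μ : 𝓑 → ℝ} {Q : 𝓑 → 𝓑 → ℝ}

lemma prependLayer_of_pos (h : 0 < μ K) : prependLayer μ Q F K = bayes μ F K :=
  if_pos h

lemma prependLayer_of_eq_zero (h : μ K = 0) : prependLayer μ Q F K = Q F K :=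
  if_neg h.not_gt

lemma isFullCondProb_prependLayer (hμ : IsFinAddProb A μ) (hQ : IsFullCondProb A Q) :
    IsFullCondProb A (prependLayer μ Q) := by
  refine isFullCondProb_of_forall_exists_bayes fun K hK hK0 => ?_
  rcases (hμ.nonneg K hK).eq_or_lt with hnull | hpos
  · refine ⟨fun F => Q F K, hQ.finAddProb K hK hK0, one_pos.trans_eq (hQ.self hK hK0).symm,
      fun L hL hLK hLpos F hF => ?_⟩
    rw [prependLayer_of_eq_zero (hμ.eq_zero_of_le hL hK hLK hnull.symm),
      ← hQ.eq_bayes hF hL hK hK0 hLpos, inf_eq_left.2 hLK]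
  · exact ⟨μ, hμ, hpos, fun L _ _ hLpos F _ => prependLayer_of_pos hLpos⟩

end PrependLayer

open Classical in
/-- The two-valued probability of the events that are implied by `U`-almost all atoms. For the
principal ultrafilter at `a` it is the Dirac probability at `a`. -/
def ultraProb (U : Ultrafilter {a : 𝓑 // IsAtom a}) (F : 𝓑) : ℝ :=
  if ∀ᶠ a : {a : 𝓑 // IsAtom a} in U, a.1 ≤ F then 1 else 0

section UltraProb

variable {U : Ultrafilter {a : 𝓑 // IsAtom a}}

lemma ultraProb_eq_one (h : ∀ᶠ a : {a : 𝓑 // IsAtom a} in U, a.1 ≤ F) : ultraProb U F = 1 :=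
  if_pos h

lemma ultraProb_eq_zero (h : ∀ᶠ a : {a : 𝓑 // IsAtom a} in U, Disjoint a.1 F) : ultraProb U F = 0 :=
  if_neg (Ultrafilter.eventually_not.1 (h.mono fun a ha => a.2.not_le_iff_disjoint.2 ha))

lemma isFinAddProb_ultraProb (U : Ultrafilter {a : 𝓑 // IsAtom a}) :
    IsFinAddProb A (ultraProb U) where
  nonneg F _ := by
    unfold ultraProb
    split_ifs <;> norm_num
  top := ultraProb_eq_one (Eventually.of_forall fun _ => le_top)
  sup_of_disjoint F _ G _ hFG := by
    rcases U.em fun a : {a : 𝓑 // IsAtom a} => a.1 ≤ F with hF | hF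
    · rw [ultraProb_eq_one hF, ultraProb_eq_one (hF.mono fun _ => le_sup_of_le_left),
        ultraProb_eq_zero (hF.mono fun _ => hFG.mono_left), add_zero]
    · have hdisj : ∀ᶠ a : {a : 𝓑 // IsAtom a} in U, Disjoint a.1 F :=
        hF.mono fun a => a.2.not_le_iff_disjoint.1
      have hiff : ∀ᶠ a : {a : 𝓑 // IsAtom a} in U, a.1 ≤ F ⊔ G ↔ a.1 ≤ G :=
        hdisj.mono fun a ha => ⟨fun h => ha.left_le_of_le_sup_left h, le_sup_of_le_right⟩
      rw [ultraProb_eq_zero hdisj, zero_add, ultraProb, ultraProb]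
      congr 1
      exact propext (eventually_congr hiff)

end UltraProb

/-! ### Extensions of a strategy -/

/-- The full conditional probabilities on `A` that extend the strategy `σ`, with no condition on
`Q(· | ⊤)`: they supply the values of the members of `extensions` on the events that are null for
the unconditional probability. -/
def strategyExtensions (H : I → 𝓑) (A : BooleanSubalgebra 𝓑) (σ : 𝓑 → I → ℝ) :
    Set (𝓑 → 𝓑 → ℝ) :=
  {Q | IsFullCondProb A Q ∧ ∀ F ∈ A, ∀ i, Q F (H i) = σ F i}

/-- The layers are the probabilities `σ(· | H i)`, followed by the Dirac probabilities at the atoms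
so that every event is charged. -/
lemma strategyExtensions_nonempty (hH : IsPartition H) (hHA : ∀ i, H i ∈ A)
    (hσ : IsStrategy H A σ) : (strategyExtensions H A σ).Nonempty := by
  let r : I ⊕ {a : 𝓑 // IsAtom a} → I ⊕ {a : 𝓑 // IsAtom a} → Prop :=
    Sum.Lex WellOrderingRel WellOrderingRel
  have : IsWellOrder _ r := inferInstanceAs (IsWellOrder _ (Sum.Lex _ _))
  let μ : I ⊕ {a : 𝓑 // IsAtom a} → 𝓑 → ℝ :=
    Sum.elim (fun i F => σ F i) fun a => ultraProb (pure a)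
  have hμ : ∀ l, IsFinAddProb A (μ l) := by
    rintro (i | a)
    · exact hσ.finAddProb i
    · exact isFinAddProb_ultraProb (pure a)
  refine ⟨lexBayes r μ, isFullCondProb_lexBayes hμ fun K _ hK0 => ?_, fun F hF i => ?_⟩
  · obtain ⟨a, ha, haK⟩ := (IsAtomic.eq_bot_or_exists_atom_le K).resolve_left hK0
    have hone : μ (Sum.inr ⟨a, ha⟩) K = 1 := ultraProb_eq_one haK
    exact ⟨Sum.inr ⟨a, ha⟩, one_pos.trans_eq hone.symm⟩
  · have hself : μ (Sum.inl i) (H i) = 1 := hσ.self hHA i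
    have hfirst : ∀ l, r l (Sum.inl i) → ¬ 0 < μ l (H i) := by
      rintro (j | a) hl
      · have hij : i ≠ j := by
          rintro rfl
          exact irrefl_of WellOrderingRel i (Sum.lex_inl_inl.1 hl)
        exact (hσ.of_disjoint hHA (hHA i) (hH.disjoint i j hij)).not_gt
      · exact (Sum.lex_inr_inl hl).elim
    rw [lexBayes_eq (one_pos.trans_eq hself.symm) hfirst, bayes, hself, div_one]
    exact hσ.inf_self hHA hF i

namespace IsCompatible

variable {μ ν : 𝓑 → ℝ} {Q : 𝓑 → 𝓑 → ℝ}

lemma prependLayer_mem_strategyExtensions (hμ : IsCompatible H A σ μ) (hHA : ∀ i, H i ∈ A)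
    (hQ : IsFullCondProb A Q) (hQσ : ∀ i, μ (H i) = 0 → ∀ F ∈ A, Q F (H i) = σ F i) :
    prependLayer μ Q ∈ strategyExtensions H A σ := by
  refine ⟨isFullCondProb_prependLayer hμ.toIsFinAddProb hQ, fun F hF i => ?_⟩
  rcases (hμ.nonneg _ (hHA i)).eq_or_lt with hnull | hpos
  · rw [prependLayer_of_eq_zero hnull.symm, hQσ i hnull.symm F hF]
  · rw [prependLayer_of_pos hpos, bayes, hμ.inf_eq_mul F hF i, mul_div_cancel_right₀ _ hpos.ne']

lemma prependLayer_mem_extensions (hμ : IsCompatible H A σ μ) (hHA : ∀ i, H i ∈ A)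
    (hQ : Q ∈ strategyExtensions H A σ) : prependLayer μ Q ∈ extensions H A μ σ := by
  obtain ⟨hfull, hσ⟩ := hμ.prependLayer_mem_strategyExtensions hHA hQ.1 fun i _ F hF => hQ.2 F hF i
  refine ⟨hfull, fun F _ => ?_, hσ⟩
  rw [prependLayer_of_pos (one_pos.trans_eq hμ.top.symm), bayes, inf_top_eq, hμ.top, div_one]

lemma extensions_nonempty (hμ : IsCompatible H A σ μ) (hH : IsPartition H) (hHA : ∀ i, H i ∈ A)
    (hσ : IsStrategy H A σ) : (extensions H A μ σ).Nonempty := by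
  obtain ⟨Q, hQ⟩ := strategyExtensions_nonempty hH hHA hσ
  exact ⟨_, hμ.prependLayer_mem_extensions hHA hQ⟩

lemma exists_strategyExtension_eq_bayes (hν : IsCompatible H A σ ν) (hH : IsPartition H)
    (hHA : ∀ i, H i ∈ A) (hσ : IsStrategy H A σ) (hK : 0 < ν K) (F : 𝓑) :
    ∃ Q ∈ strategyExtensions H A σ, Q F K = bayes ν F K := by
  obtain ⟨Q, hQ⟩ := strategyExtensions_nonempty hH hHA hσ
  exact ⟨_, hν.prependLayer_mem_strategyExtensions hHA hQ.1 fun i _ F hF => hQ.2 F hF i,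
    prependLayer_of_pos hK⟩

end IsCompatible

/-- When `σ(K | H i) = 0`, the layer `σ(· | H i)` may be followed by the Dirac probability at an
atom of `H i ∧ Fᶜ ∧ K`. -/
lemma exists_strategyExtension_eq_zero_of_inf_eq_zero (hH : IsPartition H) (hHA : ∀ i, H i ∈ A)
    (hσ : IsStrategy H A σ) (hK : K ∈ A) {i : I} (hi : H i ⊓ Fᶜ ⊓ K ≠ ⊥)
    (h0 : σ (F ⊓ K) i = 0) : ∃ Q ∈ strategyExtensions H A σ, Q F K = 0 := by
  have hσi := hσ.isCompatible hH hHA i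
  rcases (hσi.nonneg K hK).eq_or_lt with hnull | hpos
  · obtain ⟨Q, hQ⟩ := strategyExtensions_nonempty hH hHA hσ
    obtain ⟨a, ha, hai⟩ := (IsAtomic.eq_bot_or_exists_atom_le _).resolve_left hi
    obtain ⟨⟨haH, haF⟩, haK⟩ : (a ≤ H i ∧ a ≤ Fᶜ) ∧ a ≤ K := by simpa only [le_inf_iff] using hai
    let δ : 𝓑 → ℝ := ultraProb (pure ⟨a, ha⟩)
    have hδK : δ K = 1 := ultraProb_eq_one haK
    have hδFK : δ (F ⊓ K) = 0 :=
      ultraProb_eq_zero (disjoint_compl_left.mono haF inf_le_left : Disjoint a (F ⊓ K))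
    refine ⟨_, hσi.prependLayer_mem_strategyExtensions hHA
      (isFullCondProb_prependLayer (isFinAddProb_ultraProb (pure ⟨a, ha⟩)) hQ.1)
      fun j hj G hG => ?_, ?_⟩
    · have hij : i ≠ j := by
        rintro rfl
        exact one_ne_zero ((hσ.self hHA i).symm.trans hj)
      have hδj : δ (H j) = 0 :=
        ultraProb_eq_zero ((hH.disjoint i j hij).mono_left haH : Disjoint a (H j))
      rw [prependLayer_of_eq_zero hδj, hQ.2 G hG]
    · rw [prependLayer_of_eq_zero (μ := fun G => σ G i) hnull.symm,
        prependLayer_of_pos (one_pos.trans_eq hδK.symm), bayes, hδFK, zero_div]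
  · obtain ⟨Q, hQ, hQFK⟩ := hσi.exists_strategyExtension_eq_bayes hH hHA hσ hpos F
    exact ⟨Q, hQ, by rw [hQFK, bayes, h0, zero_div]⟩

/-- A free ultrafilter on the infinitely many cells gives a probability that is concentrated on
`Fᶜ ∧ K` and vanishes on every `H i`, hence is compatible with `σ`. -/
lemma exists_strategyExtension_eq_zero_of_infinite (hH : IsPartition H) (hHA : ∀ i, H i ∈ A)
    (hσ : IsStrategy H A σ) (hinf : {i | H i ⊓ Fᶜ ⊓ K ≠ ⊥}.Infinite) :
    ∃ Q ∈ strategyExtensions H A σ, Q F K = 0 := by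
  have := hinf.to_subtype
  choose a ha hai using fun i : {i | H i ⊓ Fᶜ ⊓ K ≠ ⊥} =>
    (IsAtomic.eq_bot_or_exists_atom_le _).resolve_left i.2
  simp only [le_inf_iff] at hai
  let ν : 𝓑 → ℝ := ultraProb ((hyperfilter _).map fun i => ⟨a i, ha i⟩)
  have hνK : ν K = 1 :=
    ultraProb_eq_one (eventually_map.2 (Eventually.of_forall fun i => (hai i).2))
  have hνFK : ν (F ⊓ K) = 0 :=
    ultraProb_eq_zero (eventually_map.2 (Eventually.of_forall fun i =>
      disjoint_compl_left.mono (hai i).1.2 inf_le_left))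
  have hνH : ∀ j, ν (H j) = 0 := by
    refine fun j => ultraProb_eq_zero (eventually_map.2 (hyperfilter_le_cofinite ?_))
    have hfin : {i : {i | H i ⊓ Fᶜ ⊓ K ≠ ⊥} | i.1 = j}.Finite :=
      Set.Subsingleton.finite fun _ hi _ hi' => Subtype.ext (hi.trans hi'.symm)
    filter_upwards [hfin.compl_mem_cofinite] with i hij
    exact (hH.disjoint i j hij).mono_left (hai i).1.1
  have hν : IsCompatible H A σ ν := (isFinAddProb_ultraProb _).isCompatible_of_null hHA hνH
  obtain ⟨Q, hQ, hQFK⟩ :=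
    hν.exists_strategyExtension_eq_bayes hH hHA hσ (one_pos.trans_eq hνK.symm) F
  exact ⟨Q, hQ, by rw [hQFK, bayes, hνFK, zero_div]⟩

lemma exists_strategyExtension_eq_zero_of_not_ratioCase (hH : IsPartition H) (hHA : ∀ i, H i ∈ A)
    (hσ : IsStrategy H A σ) (hF : F ∈ A) (hK : K ∈ A) (hFK : F ⊓ K ≠ K)
    (hR : ¬ RatioCase H σ F K) : ∃ Q ∈ strategyExtensions H A σ, Q F K = 0 := by
  by_cases hinf : {i | H i ⊓ Fᶜ ⊓ K ≠ ⊥}.Infinite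
  · exact exists_strategyExtension_eq_zero_of_infinite hH hHA hσ hinf
  obtain ⟨i, hi, h0⟩ : ∃ i, H i ⊓ Fᶜ ⊓ K ≠ ⊥ ∧ σ (F ⊓ K) i = 0 := by
    by_contra! h
    have hσi i := hσ.finAddProb i
    have hI₂ : ∀ i, H i ⊓ Fᶜ ⊓ K ≠ ⊥ → i ∈ I₂ H F K := fun i hi => ⟨fun hbot => h i hi <|
      hσ.of_disjoint hHA (BooleanSubalgebra.inf_mem hF hK)
        (disjoint_iff.2 (by rw [inf_comm, ← inf_assoc, hbot])), hi⟩
    obtain ⟨i, hi⟩ := hH.exists_inf_ne_bot (B := Fᶜ ⊓ K) fun hbot =>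
      hFK (inf_eq_right.2 (disjoint_compl_left_iff.1 (disjoint_iff.2 hbot)))
    rw [← inf_assoc] at hi
    refine hR ⟨⟨i, hI₂ i hi⟩, eq_empty_of_forall_notMem fun j hj => (hI₂ j hj.2).1 hj.1,
      (not_infinite.1 hinf).subset fun j hj => hj.2, fun j hj => ?_⟩
    refine ((hσi j).nonneg K hK).lt_of_ne' fun hnull => h j hj.2 ?_
    exact (hσi j).eq_zero_of_le (BooleanSubalgebra.inf_mem hF hK) hK inf_le_right hnull
  exact exists_strategyExtension_eq_zero_of_inf_eq_zero hH hHA hσ hK hi h0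

/-! ### The lower envelope -/

lemma lowerEnvelope_eq_of_isLeast {α : Type*} {S : Set (α → α → ℝ)} {F K : α} {m : ℝ}
    (h : IsLeast ((fun P => P F K) '' S) m) : lowerEnvelope S F K = m :=
  h.csInf_eq

lemma RatioCase.exists_isLeast (hR : RatioCase H σ F K) :
    ∃ i ∈ I₂ H F K, IsLeast ((fun i => σ (F ⊓ K) i / σ K i) '' I₂ H F K)
      (σ (F ⊓ K) i / σ K i) := by
  obtain ⟨i, hi, hmin⟩ := exists_min_image _ (fun i => σ (F ⊓ K) i / σ K i) hR.2.2.1 hR.1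
  exact ⟨i, hi, mem_image_of_mem _ hi, forall_mem_image.2 hmin⟩

/-- `Fᶜ ∧ K` is covered by the finitely many cells in `I₂`, and on these the conditional
probabilities are given by the strategy. -/
lemma RatioCase.le_of_mem_strategyExtensions {Q : 𝓑 → 𝓑 → ℝ} (hR : RatioCase H σ F K)
    (hH : IsPartition H) (hHA : ∀ i, H i ∈ A) (hQ : Q ∈ strategyExtensions H A σ) (hF : F ∈ A)
    (hK : K ∈ A) (hK0 : K ≠ ⊥) {m : ℝ} (hm1 : m ≤ 1)
    (hm : ∀ i ∈ I₂ H F K, m ≤ σ (F ⊓ K) i / σ K i) : m ≤ Q F K := by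
  obtain ⟨-, h3, hfin, hpos⟩ := hR
  have hcov : Fᶜ ⊓ K ≤ hfin.toFinset.sup H := hH.le_of_forall_cell_le fun i hi => by
    rw [← inf_assoc] at hi
    have hi₂ : H i ⊓ F ⊓ K ≠ ⊥ := fun h => (h3 ▸ ⟨h, hi⟩ : i ∈ (∅ : Set I))
    exact Finset.le_sup (hfin.mem_toFinset.2 ⟨hi₂, hi⟩)
  refine hQ.1.le_of_forall_le hF hK hK0 (fun i _ => hHA i)
    (fun i _ j _ hij => hH.disjoint i j hij) hcov (fun i hi hbot => ?_) hm1 fun i hi => ?_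
  · exact (hfin.mem_toFinset.1 hi).1 (by rw [inf_right_comm, hbot, bot_inf_eq])
  · have hi₂ := hfin.mem_toFinset.1 hi
    have hQpos : 0 < Q K (H i) := (hpos i hi₂).trans_eq (hQ.2 K hK i).symm
    rw [inf_comm, hQ.1.eq_bayes hF hK (hHA i) (hH.ne_bot i) hQpos, bayes, hQ.2 K hK,
      hQ.2 _ (BooleanSubalgebra.inf_mem hF hK)]
    exact hm i hi₂

namespace IsCompatible

variable {μ : 𝓑 → ℝ}

lemma isLeast_of_null (hμ : IsCompatible H A σ μ) (hHA : ∀ i, H i ∈ A) (hK : μ K = 0) {m : ℝ}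
    (hex : ∃ Q ∈ strategyExtensions H A σ, Q F K = m)
    (hle : ∀ Q ∈ strategyExtensions H A σ, m ≤ Q F K) :
    IsLeast ((fun P => P F K) '' extensions H A μ σ) m := by
  obtain ⟨Q, hQ, hQm⟩ := hex
  exact ⟨⟨_, hμ.prependLayer_mem_extensions hHA hQ, (prependLayer_of_eq_zero hK).trans hQm⟩,
    forall_mem_image.2 fun P hP => hle P ⟨hP.1, hP.2.2⟩⟩

lemma isLeast_of_forall_eq (hμ : IsCompatible H A σ μ) (hH : IsPartition H) (hHA : ∀ i, H i ∈ A)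
    (hσ : IsStrategy H A σ) {m : ℝ} (h : ∀ P ∈ extensions H A μ σ, P F K = m) :
    IsLeast ((fun P => P F K) '' extensions H A μ σ) m := by
  obtain ⟨P, hP⟩ := hμ.extensions_nonempty hH hHA hσ
  exact ⟨⟨P, hP, h P hP⟩, forall_mem_image.2 fun P hP => (h P hP).ge⟩

lemma isLeast_one (hμ : IsCompatible H A σ μ) (hH : IsPartition H) (hHA : ∀ i, H i ∈ A)
    (hσ : IsStrategy H A σ) (hF : F ∈ A) (hK : K ∈ A) (hK0 : K ≠ ⊥) (h : F ⊓ K = K) :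
    IsLeast ((fun P => P F K) '' extensions H A μ σ) 1 :=
  hμ.isLeast_of_forall_eq hH hHA hσ fun _ hP => hP.1.eq_one hF hK hK0 h

lemma isLeast_bayes (hμ : IsCompatible H A σ μ) (hH : IsPartition H) (hHA : ∀ i, H i ∈ A)
    (hσ : IsStrategy H A σ) (hF : F ∈ A) (hK : K ∈ A) (hK0 : K ≠ ⊥) (hpos : 0 < μ K) :
    IsLeast ((fun P => P F K) '' extensions H A μ σ) (μ (F ⊓ K) / μ K) := by
  refine hμ.isLeast_of_forall_eq hH hHA hσ fun P hP => ?_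
  have hP' := hP.1.eq_bayes hF hK BooleanSubalgebra.top_mem (ne_bot_of_le_ne_bot hK0 le_top)
    (hpos.trans_eq (hP.2.1 K hK).symm)
  rwa [inf_top_eq, bayes, hP.2.1 _ (BooleanSubalgebra.inf_mem hF hK), hP.2.1 K hK] at hP'

lemma isLeast_ratio (hμ : IsCompatible H A σ μ) (hH : IsPartition H) (hHA : ∀ i, H i ∈ A)
    (hσ : IsStrategy H A σ) (hF : F ∈ A) (hK : K ∈ A) (hK0 : K ≠ ⊥) (hnull : μ K = 0)
    (hR : RatioCase H σ F K) {m : ℝ}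
    (hm : IsLeast ((fun i => σ (F ⊓ K) i / σ K i) '' I₂ H F K) m) :
    IsLeast ((fun P => P F K) '' extensions H A μ σ) m := by
  obtain ⟨⟨i, hi, rfl⟩, hmin⟩ := hm
  have hσi := hσ.isCompatible hH hHA i
  have hle_one : σ (F ⊓ K) i / σ K i ≤ 1 :=
    (hσi.isFinAddProb_bayes hK (hR.2.2.2 i hi)).le_one hF
  exact hμ.isLeast_of_null hHA hnull
    (hσi.exists_strategyExtension_eq_bayes hH hHA hσ (hR.2.2.2 i hi) F) fun Q hQ =>
      hR.le_of_mem_strategyExtensions hH hHA hQ hF hK hK0 hle_one (forall_mem_image.1 hmin)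

lemma isLeast_zero (hμ : IsCompatible H A σ μ) (hH : IsPartition H) (hHA : ∀ i, H i ∈ A)
    (hσ : IsStrategy H A σ) (hF : F ∈ A) (hK : K ∈ A) (hK0 : K ≠ ⊥) (hnull : μ K = 0)
    (hFK : F ⊓ K ≠ K) (hR : ¬ RatioCase H σ F K) :
    IsLeast ((fun P => P F K) '' extensions H A μ σ) 0 :=
  hμ.isLeast_of_null hHA hnull
    (exists_strategyExtension_eq_zero_of_not_ratioCase hH hHA hσ hF hK hFK hR)
    fun _ hQ => (hQ.1.finAddProb K hK hK0).nonneg F hF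

lemma exists_isLeast (hμ : IsCompatible H A σ μ) (hH : IsPartition H) (hHA : ∀ i, H i ∈ A)
    (hσ : IsStrategy H A σ) (hF : F ∈ A) (hK : K ∈ A) (hK0 : K ≠ ⊥) :
    ∃ m, IsLeast ((fun P => P F K) '' extensions H A μ σ) m := by
  by_cases hFK : F ⊓ K = K
  · exact ⟨_, hμ.isLeast_one hH hHA hσ hF hK hK0 hFK⟩
  rcases (hμ.nonneg K hK).eq_or_lt with hnull | hpos
  · by_cases hR : RatioCase H σ F K
    · obtain ⟨i, -, hi⟩ := hR.exists_isLeast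
      exact ⟨_, hμ.isLeast_ratio hH hHA hσ hF hK hK0 hnull.symm hR hi⟩
    · exact ⟨_, hμ.isLeast_zero hH hHA hσ hF hK hK0 hnull.symm hFK hR⟩
  · exact ⟨_, hμ.isLeast_bayes hH hHA hσ hF hK hK0 hpos⟩

end IsCompatible

end Envelope

end

theorem theorem3_general {𝓑 I : Type*} [CompleteAtomicBooleanAlgebra 𝓑]
    (H : I → 𝓑) (hH : Envelope.IsPartition H) (AL A : BooleanSubalgebra 𝓑)
    (hAL : Envelope.IsDenseIn H AL) (hHA : ∀ i, H i ∈ A)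
    (π : 𝓑 → ℝ) (hπ : Envelope.IsFinAddProb AL π)
    (σ : 𝓑 → I → ℝ) (hσ : Envelope.IsStrategy H A σ)
    (hcont : ∀ F ∈ A, Envelope.IsAlgContinuous H AL (σ F)) :
    (∀ F ∈ A, Envelope.IsSIntegrable H AL π (σ F)) ∧
    ∀ Pd : 𝓑 → ℝ, Pd = Envelope.disintegrableJoint H AL π σ →
    ∀ 𝓟 : Set (𝓑 → 𝓑 → ℝ), 𝓟 = Envelope.extensions H A Pd σ →
    ∀ F ∈ A, ∀ K ∈ A, K ≠ ⊥ →
      IsLeast ((fun P => P F K) '' 𝓟) (Envelope.lowerEnvelope 𝓟 F K) ∧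
      (F ⊓ K = K → Envelope.lowerEnvelope 𝓟 F K = 1) ∧
      (F ⊓ K ≠ K →
        (0 < Pd K → Envelope.lowerEnvelope 𝓟 F K = Pd (F ⊓ K) / Pd K) ∧
        (Pd K = 0 →
          (Envelope.RatioCase H σ F K →
            IsLeast ((fun i => σ (F ⊓ K) i / σ K i) '' Envelope.I₂ H F K)
              (Envelope.lowerEnvelope 𝓟 F K)) ∧
          (¬ Envelope.RatioCase H σ F K → Envelope.lowerEnvelope 𝓟 F K = 0))) := by
  refine ⟨fun F hF => (hcont F hF).isSIntegrable hH hAL hπ, ?_⟩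
  have hPd := Envelope.isCompatible_disintegrableJoint hH hAL hHA hπ hσ hcont
  rintro _ rfl _ rfl F hF K hK hK0
  obtain ⟨m, hm⟩ := hPd.exists_isLeast hH hHA hσ hF hK hK0
  refine ⟨?_, fun hFK => ?_, fun hFK => ⟨fun hpos => ?_, fun hnull =>
    ⟨fun hR => ?_, fun hR => ?_⟩⟩⟩
  · rwa [Envelope.lowerEnvelope_eq_of_isLeast hm]
  · exact Envelope.lowerEnvelope_eq_of_isLeast (hPd.isLeast_one hH hHA hσ hF hK hK0 hFK)
  · exact Envelope.lowerEnvelope_eq_of_isLeast (hPd.isLeast_bayes hH hHA hσ hF hK hK0 hpos)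
  · obtain ⟨i, -, hi⟩ := hR.exists_isLeast
    rwa [Envelope.lowerEnvelope_eq_of_isLeast (hPd.isLeast_ratio hH hHA hσ hF hK hK0 hnull hR hi)]
  · exact Envelope.lowerEnvelope_eq_of_isLeast (hPd.isLeast_zero hH hHA hσ hF hK hK0 hnull hFK hR)

theorem theorem3 {𝓑 I J : Type*} [CompleteAtomicBooleanAlgebra 𝓑]
    (H : I → 𝓑) (E : J → 𝓑) (hH : Envelope.IsPartition H) (hE : Envelope.IsPartition E)
    (AL AE A : BooleanSubalgebra 𝓑)
    (hAL : BooleanSubalgebra.closure (Set.range H) ≤ AL)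
    (hAL' : AL ≤ Envelope.completeClosure (Set.range H))
    (hAE : BooleanSubalgebra.closure (Set.range E) ≤ AE)
    (hAE' : AE ≤ Envelope.completeClosure (Set.range E))
    (hA : BooleanSubalgebra.closure ((AL : Set 𝓑) ∪ (AE : Set 𝓑)) ≤ A)
    (hA' : A ≤ Envelope.completeClosure ((AL : Set 𝓑) ∪ (AE : Set 𝓑)))
    (π : 𝓑 → ℝ) (hπ : Envelope.IsFinAddProb AL π)
    (σ : 𝓑 → I → ℝ) (hσ : Envelope.IsStrategy H A σ)
    (hcont : ∀ F ∈ A, Envelope.IsAlgContinuous H AL (σ F)) :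
    -- the integrals that define the disintegrable joint probability exist
    (∀ F ∈ A, Envelope.IsSIntegrable H AL π (σ F)) ∧
    ∀ Pd : 𝓑 → ℝ, Pd = Envelope.disintegrableJoint H AL π σ →
    ∀ 𝓟 : Set (𝓑 → 𝓑 → ℝ), 𝓟 = Envelope.extensions H A Pd σ →
    ∀ F ∈ A, ∀ K ∈ A, K ≠ ⊥ →
      -- the lower envelope is attained
      IsLeast ((fun P => P F K) '' 𝓟) (Envelope.lowerEnvelope 𝓟 F K) ∧
      (F ⊓ K = K → Envelope.lowerEnvelope 𝓟 F K = 1) ∧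
      (F ⊓ K ≠ K →
        (0 < Pd K → Envelope.lowerEnvelope 𝓟 F K = Pd (F ⊓ K) / Pd K) ∧
        (Pd K = 0 →
          (Envelope.RatioCase H σ F K →
            IsLeast ((fun i => σ (F ⊓ K) i / σ K i) '' Envelope.I₂ H F K)
              (Envelope.lowerEnvelope 𝓟 F K)) ∧
          (¬ Envelope.RatioCase H σ F K → Envelope.lowerEnvelope 𝓟 F K = 0))) := by
  have hHAL i : H i ∈ AL := hAL (BooleanSubalgebra.subset_closure ⟨i, rfl⟩)
  exact theorem3_general H hH AL A (hH.isDenseIn hAL')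
    (fun i => hA (BooleanSubalgebra.subset_closure (Or.inl (hHAL i)))) π hπ σ hσ hcont
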